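/- Let $k$ be a field of characteristic zero and let $H$ be a commutative Hopf algebra over $k$ which is connected, i.e. its coradical (the sum of all simple subcoalgebras of $H$) is one-dimensional over $k$. Let $K$ be a Hopf subalgebra of $H$. Then $H$ is isomorphic, as a $K$-algebra, to the polynomial algebra $K[x_\gamma \mid \gamma\in\Gamma]$ over $K$ in some (possibly infinite or empty) family of variables $(x_\gamma)_{\gamma\in\Gamma}$. -/

import Mathlib

universe u v

/-- A subspace `D` of a coalgebra `C` over a field `k` is a subcoalgebra if `Δ(D) ⊆ D ⊗ D`,
where `D ⊗ D` is regarded as a subspace of `C ⊗ C`. -/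
def IsSubcoalgebra (k : Type*) {C : Type*} [Field k] [AddCommGroup C] [Module k C]
    [Coalgebra k C] (D : Submodule k C) : Prop :=
  ∀ x ∈ D, Coalgebra.comul (R := k) x ∈
    LinearMap.range (TensorProduct.map D.subtype D.subtype)

/-- A simple subcoalgebra: a nonzero subcoalgebra whose only subcoalgebras are `0` and itself. -/
structure IsSimpleSubcoalgebra (k : Type*) {C : Type*} [Field k] [AddCommGroup C] [Module k C]
    [Coalgebra k C] (D : Submodule k C) : Prop where
  isSubcoalgebra : IsSubcoalgebra k D
  ne_bot : D ≠ ⊥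
  eq_bot_or_eq : ∀ E : Submodule k C, IsSubcoalgebra k E → E ≤ D → E = ⊥ ∨ E = D

/-- The coradical of a coalgebra: the sum of all its simple subcoalgebras. -/
def coradical (k : Type*) (C : Type*) [Field k] [AddCommGroup C] [Module k C]
    [Coalgebra k C] : Submodule k C :=
  sSup {D : Submodule k C | IsSimpleSubcoalgebra k D}

/-- A Hopf algebra is connected if its coradical is one-dimensional. -/
def IsConnectedHopfAlgebra (k : Type*) (H : Type*) [Field k] [Ring H] [HopfAlgebra k H] : Prop :=
  Module.finrank k (coradical k H) = 1

/-- A Hopf subalgebra of a Hopf algebra: a (unital) subalgebra which is a subcoalgebra and is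
stable under the antipode. -/
structure IsHopfSubalgebra {k : Type*} {H : Type*} [Field k] [Ring H] [HopfAlgebra k H]
    (K : Subalgebra k H) : Prop where
  isSubcoalgebra : IsSubcoalgebra k (Subalgebra.toSubmodule K)
  antipode_mem : ∀ x ∈ K, HopfAlgebra.antipode k x ∈ K

/-! Zorn's lemma gives a maximal set S that is algebraically independent over K and for which E =
K[S] is a Hopf subalgebra. If E ≠ H, one enlarges S by an element x outside E that is primitive
modulo E, i.e. Δx − x⊗1 − 1⊗x ∈ E⊗E. Then E[x] is again a Hopf subalgebra, and two facts give the
contradiction.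

Existence of x (`exists_primitive_mod`). Connectedness forces every nonzero subcoalgebra to contain
1. By duality, an operator in the dual action that annihilates a nonzero cyclic submodule of H/E is
then killed by the character "evaluate at 1". As the action is locally finite, H/E contains an
eigenvector for this character, i.e. a coinvariant. Doing this on one side and then on the other
yields x.

Transcendence of x (`IsHopfSubalgebra.transcendental`). The leading coefficients of degree d
relations for x over E form an ideal of E that is a right coideal, hence is zero or contains 1. In a
monic relation of minimal degree d > 0, comparing the coefficients of (x⊗1)^(d−1) after applying Δ
gives d·x ∈ E, which characteristic zero forbids. -/

open TensorProduct

/-! ### Eigenvectors of locally finite modules -/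

section Eigenvector

variable {k : Type*} [Field k]

/-- If a character kills the annihilator of a finite-dimensional simple module, then the module
contains a nonzero vector on which the algebra acts through this character. -/
theorem exists_eigenvector_of_annihilator_le_ker {A S : Type*} [Ring A] [Algebra k A]
    [AddCommGroup S] [Module k S] [Module A S] [IsScalarTower k A S] [FiniteDimensional k S]
    [IsSimpleModule A S] (χ : A →ₐ[k] k) (h : ∀ a : A, (∀ s : S, a • s = 0) → χ a = 0) :
    ∃ v : S, v ≠ 0 ∧ ∀ a : A, a • v = χ a • v := by
  classical
  let b := Module.finBasis k S
  let φ : A →ₗ[A] (Fin (Module.finrank k S) → S) :=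
    LinearMap.pi fun i => LinearMap.toSpanSingleton A S (b i)
  have hφ : ∀ a, φ a = 0 → ∀ s : S, a • s = 0 := by
    intro a ha s
    have : (DistribSMul.toLinearMap k S a : S →ₗ[k] S) = 0 := by
      refine b.ext fun i => ?_
      simpa [φ] using congrFun ha i
    simpa using LinearMap.congr_fun this s
  let m : Ideal A := RingHom.ker χ.toRingHom
  have hm : ∀ a, a ∈ m ↔ χ a = 0 := fun a => by simp [m, RingHom.mem_ker]
  -- The range of φ sits in a finite power of the simple module S, so it is semisimple. Its copy of
  -- A / Ann(S) lets 1 split along m and Q.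
  obtain ⟨Q, hQ⟩ := exists_isCompl (Submodule.map φ.rangeRestrict m)
  have h1 : φ.rangeRestrict 1 ∈ Submodule.map φ.rangeRestrict m ⊔ Q := by
    rw [hQ.sup_eq_top]; trivial
  obtain ⟨_, ⟨c, hc, rfl⟩, z, hz, hcz⟩ := Submodule.mem_sup.1 h1
  obtain ⟨q, rfl⟩ := φ.surjective_rangeRestrict z
  -- c + q − 1 annihilates S, so χ kills it, while χ c = 0.
  have hqm : χ q = 1 := by
    have : φ (c + q - 1) = 0 := by
      have := congrArg Subtype.val hcz
      simp only [map_sub, map_add]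
      simpa [sub_eq_zero] using this
    have := h _ (hφ _ this)
    have hc' := (hm c).1 hc
    simp [hc'] at this
    linear_combination this
  have hq : ∃ s : S, q • s ≠ 0 := by
    by_contra! hs
    simp [h q hs] at hqm
  obtain ⟨s, hs⟩ := hq
  -- For a in m, the image of a * q lies both in the image of m and in Q, hence is zero.
  have key : ∀ a ∈ m, a • (q • s) = 0 := by
    intro a ha
    rw [← mul_smul]
    refine hφ _ ?_ s
    have h2 : φ.rangeRestrict (a * q) ∈ Submodule.map φ.rangeRestrict m ⊓ Q := by
      refine ⟨⟨a * q, (hm _).2 (by simp [(hm a).1 ha]), rfl⟩, ?_⟩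
      have := Q.smul_mem a hz
      rwa [← map_smul, smul_eq_mul] at this
    rw [hQ.inf_eq_bot] at h2
    exact congrArg Subtype.val ((Submodule.mem_bot _).1 h2)
  refine ⟨q • s, hs, fun a => ?_⟩
  have := key (a - algebraMap k A (χ a)) ((hm _).2 (by simp))
  rwa [sub_smul, sub_eq_zero, algebraMap_smul] at this

/-- Let `A` be an algebra acting locally finitely on `M`. If the annihilator of every nonzero cyclic
submodule is killed by a character `χ`, then every nonzero submodule contains an eigenvector
of `A` with character `χ`. -/
theorem exists_eigenvector_of_locallyFinite {A M : Type*} [Ring A] [Algebra k A]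
    [AddCommGroup M] [Module k M] [Module A M] [IsScalarTower k A M] (χ : A →ₐ[k] k)
    (hfin : ∀ x : M, ∃ W : Submodule k M, FiniteDimensional k W ∧ ∀ a : A, a • x ∈ W)
    (h : ∀ (a : A) (x : M), x ≠ 0 → (∀ b : A, a • b • x = 0) → χ a = 0)
    {x : M} (hx : x ≠ 0) :
    ∃ v ∈ Submodule.span A {x}, v ≠ 0 ∧ ∀ a : A, a • v = χ a • v := by
  set Q : Submodule A M := Submodule.span A {x} with hQ
  obtain ⟨W, hW, hWx⟩ := hfin x
  have hQfin : FiniteDimensional k Q := by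
    have : Q.restrictScalars k ≤ W := by
      intro y hy
      obtain ⟨T, rfl⟩ := Submodule.mem_span_singleton.1 hy
      exact hWx T
    exact Submodule.finiteDimensional_of_le this
  have hart : IsArtinian A Q := isArtinian_of_tower k inferInstance
  have hart' : IsAtomic (Submodule A Q) := inferInstance
  have hne : (⊤ : Submodule A Q) ≠ ⊥ := by
    intro htop
    have : (⟨x, Submodule.mem_span_singleton_self _⟩ : Q) ∈ (⊤ : Submodule A Q) := trivial
    rw [htop, Submodule.mem_bot] at this
    exact hx (congrArg Subtype.val this)
  obtain ⟨S, hS, -⟩ := (eq_bot_or_exists_atom_le (⊤ : Submodule A Q)).resolve_left hne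
  have hsimple : IsSimpleModule A S := isSimpleModule_iff_isAtom.2 hS
  have hSfin : FiniteDimensional k S :=
    inferInstanceAs (FiniteDimensional k (S.restrictScalars k))
  obtain ⟨v, hv0, hv⟩ := exists_eigenvector_of_annihilator_le_ker (S := S) χ (by
    intro T hT
    obtain ⟨s, hs, hs0⟩ := (Submodule.ne_bot_iff _).1 hS.1
    refine h T (s : M) (fun h0 => hs0 (Subtype.ext h0)) fun T' => ?_
    exact congrArg (fun z : S => ((z : Q) : M)) (hT (T' • ⟨s, hs⟩)))
  exact ⟨v, (v : Q).2, fun h0 => hv0 (Subtype.ext (Subtype.ext h0)),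
    fun a => congrArg (fun z : S => ((z : Q) : M)) (hv a)⟩

/-- Let `A` be an algebra acting locally finitely on `V`, and `D`, `N` submodules with `N ≰ D`.
If the annihilator of every nonzero cyclic submodule of `V ⧸ D` is killed by a character `χ`,
then `N` contains an eigenvector of `A` modulo `D` with character `χ`. -/
theorem exists_eigenvector_mod {A V : Type*} [Ring A] [Algebra k A]
    [AddCommGroup V] [Module k V] [Module A V] [IsScalarTower k A V] (χ : A →ₐ[k] k)
    (hfin : ∀ x : V, ∃ W : Submodule k V, FiniteDimensional k W ∧ ∀ a : A, a • x ∈ W)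
    (D N : Submodule A V) (hDN : ¬ N ≤ D)
    (h : ∀ (a : A) (x : V), x ∉ D → (∀ b : A, a • b • x ∈ D) → χ a = 0) :
    ∃ x ∈ N, x ∉ D ∧ ∀ a : A, a • x - χ a • x ∈ D := by
  obtain ⟨x, hxN, hxD⟩ := SetLike.not_le_iff_exists.1 hDN
  have hx0 : D.mkQ x ≠ 0 := by simpa using hxD
  obtain ⟨v, hvx, hv0, hv⟩ := exists_eigenvector_of_locallyFinite χ (by
    intro y
    obtain ⟨y, rfl⟩ := D.mkQ_surjective y
    obtain ⟨W, hW, hWy⟩ := hfin y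
    exact ⟨W.map (D.mkQ.restrictScalars k), inferInstance, fun a => ⟨a • y, hWy a, rfl⟩⟩) (by
    intro a y hy hya
    obtain ⟨y, rfl⟩ := D.mkQ_surjective y
    refine h a y (by simpa using hy) fun b => ?_
    have := hya b
    rw [← map_smul, ← map_smul] at this
    exact (Submodule.Quotient.mk_eq_zero D).1 this) hx0
  obtain ⟨b, rfl⟩ := Submodule.mem_span_singleton.1 hvx
  refine ⟨b • x, N.smul_mem b hxN, fun hb => hv0 ?_, fun a => ?_⟩
  · rw [← map_smul]
    exact (Submodule.Quotient.mk_eq_zero D).2 hb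
  · rw [← Submodule.Quotient.mk_eq_zero]
    have := hv a
    rw [← sub_eq_zero] at this
    exact this

end Eigenvector

/-! ### Tensors tested by their slices -/

section Slices

variable {k : Type*} [Field k] {V W : Type*} [AddCommGroup V] [Module k V]
  [AddCommGroup W] [Module k W]

/-- The map `id ⊗ f : V ⊗ W → V` for a functional `f` on `W`. -/
noncomputable def sliceRight (V : Type*) [AddCommGroup V] [Module k V] (f : W →ₗ[k] k) :
    V ⊗[k] W →ₗ[k] V :=
  (TensorProduct.rid k V).toLinearMap ∘ₗ f.lTensor V

/-- The map `f ⊗ id : V ⊗ W → W` for a functional `f` on `V`. -/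
noncomputable def sliceLeft (W : Type*) [AddCommGroup W] [Module k W] (f : V →ₗ[k] k) :
    V ⊗[k] W →ₗ[k] W :=
  (TensorProduct.lid k W).toLinearMap ∘ₗ f.rTensor W

@[simp] theorem sliceRight_tmul (f : W →ₗ[k] k) (x : V) (y : W) :
    sliceRight V f (x ⊗ₜ y) = f y • x := by
  simp [sliceRight]

@[simp] theorem sliceLeft_tmul (f : V →ₗ[k] k) (x : V) (y : W) :
    sliceLeft W f (x ⊗ₜ y) = f x • y := by
  simp [sliceLeft]

theorem eq_zero_of_sliceRight {z : V ⊗[k] W} (h : ∀ f : W →ₗ[k] k, sliceRight V f z = 0) :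
    z = 0 := by
  classical
  let b := Module.Free.chooseBasis k W
  apply (TensorProduct.equivFinsuppOfBasisRight b).injective
  ext i
  have : ∀ z : V ⊗[k] W, TensorProduct.equivFinsuppOfBasisRight b z i =
      sliceRight V (b.coord i) z := by
    intro z
    induction z with
    | zero => simp
    | tmul x y => simp
    | add x y hx hy => simp [hx, hy]
  simp [this, h]

theorem eq_zero_of_sliceLeft {z : V ⊗[k] W} (h : ∀ f : V →ₗ[k] k, sliceLeft W f z = 0) :
    z = 0 := by
  apply (TensorProduct.comm k V W).injective
  rw [map_zero]
  refine eq_zero_of_sliceRight fun f => ?_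
  rw [← h f]
  clear h
  induction z with
  | zero => simp
  | tmul x y => simp
  | add x y hx hy => simp [hx, hy]

/-- A tensor lies in `D ⊗ E` if and only if all its slices lie in `D` and `E`. -/
theorem mem_range_map_subtype_iff {D : Submodule k V} {E : Submodule k W} {z : V ⊗[k] W} :
    z ∈ LinearMap.range (TensorProduct.map D.subtype E.subtype) ↔
      (∀ f : W →ₗ[k] k, sliceRight V f z ∈ D) ∧ ∀ f : V →ₗ[k] k, sliceLeft W f z ∈ E := by
  constructor
  · rintro ⟨z, rfl⟩
    constructor <;> intro f <;> induction z with
    | zero => simp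
    | tmul x y => simp [Submodule.smul_mem]
    | add x y hx hy => simpa using add_mem hx hy
  · rintro ⟨h1, h2⟩
    -- Linear retractions onto D and E fix every slice of z, hence fix z itself.
    obtain ⟨p, hp⟩ := D.subtype.exists_leftInverse_of_injective D.ker_subtype
    obtain ⟨q, hq⟩ := E.subtype.exists_leftInverse_of_injective E.ker_subtype
    have hp' : ∀ x ∈ D, (p x : V) = x := fun x hx =>
      congrArg Subtype.val (LinearMap.congr_fun hp ⟨x, hx⟩)
    have hq' : ∀ x ∈ E, (q x : W) = x := fun x hx =>
      congrArg Subtype.val (LinearMap.congr_fun hq ⟨x, hx⟩)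
    have e1 : (D.subtype ∘ₗ p).rTensor W z = z := by
      rw [← sub_eq_zero]
      refine eq_zero_of_sliceRight fun f => ?_
      have : sliceRight V f ((D.subtype ∘ₗ p).rTensor W z) =
          (D.subtype ∘ₗ p) (sliceRight V f z) := by
        clear h1 h2
        induction z with
        | zero => simp
        | tmul x y => simp
        | add x y hx hy => simp only [map_add, hx, hy]
      rw [map_sub, this, sub_eq_zero]
      exact hp' _ (h1 f)
    have e2 : (E.subtype ∘ₗ q).lTensor V z = z := by
      rw [← sub_eq_zero]
      refine eq_zero_of_sliceLeft fun f => ?_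
      have : sliceLeft W f ((E.subtype ∘ₗ q).lTensor V z) =
          (E.subtype ∘ₗ q) (sliceLeft W f z) := by
        clear h1 h2 e1
        induction z with
        | zero => simp
        | tmul x y => simp
        | add x y hx hy => simp only [map_add, hx, hy]
      rw [map_sub, this, sub_eq_zero]
      exact hq' _ (h2 f)
    refine ⟨TensorProduct.map p q z, ?_⟩
    conv_rhs => rw [← e1, ← e2]
    rw [LinearMap.rTensor, LinearMap.lTensor, ← LinearMap.comp_apply, ← LinearMap.comp_apply,
      ← TensorProduct.map_comp, ← TensorProduct.map_comp, LinearMap.comp_id, LinearMap.id_comp]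

theorem exists_finiteDimensional_sliceRight (z : V ⊗[k] W) :
    ∃ U : Submodule k V, FiniteDimensional k U ∧ ∀ f : W →ₗ[k] k, sliceRight V f z ∈ U := by
  induction z with
  | zero => exact ⟨⊥, inferInstance, by simp⟩
  | tmul x y =>
    exact ⟨k ∙ x, inferInstance, fun f => by
      simpa using Submodule.smul_mem _ _ (Submodule.mem_span_singleton_self x)⟩
  | add x y hx hy =>
    obtain ⟨U, hU, hx⟩ := hx
    obtain ⟨U', hU', hy⟩ := hy
    exact ⟨U ⊔ U', inferInstance, fun f => by
      rw [map_add]; exact Submodule.add_mem_sup (hx f) (hy f)⟩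

theorem exists_finiteDimensional_sliceLeft (z : V ⊗[k] W) :
    ∃ U : Submodule k W, FiniteDimensional k U ∧ ∀ f : V →ₗ[k] k, sliceLeft W f z ∈ U := by
  induction z with
  | zero => exact ⟨⊥, inferInstance, by simp⟩
  | tmul x y =>
    exact ⟨k ∙ y, inferInstance, fun f => by
      simpa using Submodule.smul_mem _ _ (Submodule.mem_span_singleton_self y)⟩
  | add x y hx hy =>
    obtain ⟨U, hU, hx⟩ := hx
    obtain ⟨U', hU', hy⟩ := hy
    exact ⟨U ⊔ U', inferInstance, fun f => by
      rw [map_add]; exact Submodule.add_mem_sup (hx f) (hy f)⟩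

end Slices

/-! ### The two actions of the dual on a coalgebra -/

section Coalgebra

open Coalgebra

variable {k : Type*} [Field k] {C : Type*} [AddCommGroup C] [Module k C] [Coalgebra k C]

/-- The left action `x ↦ ∑ x₁ f(x₂)` of a functional `f` on a coalgebra. -/
noncomputable def leftHit (f : C →ₗ[k] k) : Module.End k C := sliceRight C f ∘ₗ comul

/-- The right action `x ↦ ∑ f(x₁) x₂` of a functional `f` on a coalgebra. -/
noncomputable def rightHit (f : C →ₗ[k] k) : Module.End k C := sliceLeft C f ∘ₗ comul

theorem leftHit_apply (f : C →ₗ[k] k) (x : C) : leftHit f x = sliceRight C f (comul x) := rfl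

theorem rightHit_apply (f : C →ₗ[k] k) (x : C) : rightHit f x = sliceLeft C f (comul x) := rfl

theorem isSubcoalgebra_iff {D : Submodule k C} :
    IsSubcoalgebra k D ↔ ∀ x ∈ D, ∀ f : C →ₗ[k] k, leftHit f x ∈ D ∧ rightHit f x ∈ D := by
  simp only [IsSubcoalgebra, mem_range_map_subtype_iff, leftHit_apply, rightHit_apply,
    ← forall_and]

theorem counit_leftHit (f : C →ₗ[k] k) (x : C) : counit (R := k) (leftHit f x) = f x := by
  have h : ∀ z : C ⊗[k] C, counit (R := k) (sliceRight C f z) =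
      f (sliceLeft C (counit (R := k)) z) := by
    intro z
    induction z with
    | zero => simp
    | tmul x y => simp [mul_comm]
    | add x y hx hy => simp [hx, hy]
  rw [leftHit_apply, h, sliceLeft, LinearMap.comp_apply, rTensor_counit_comul]
  simp

theorem counit_rightHit (f : C →ₗ[k] k) (x : C) : counit (R := k) (rightHit f x) = f x := by
  have h : ∀ z : C ⊗[k] C, counit (R := k) (sliceLeft C f z) =
      f (sliceRight C (counit (R := k)) z) := by
    intro z
    induction z with
    | zero => simp
    | tmul x y => simp [mul_comm]
    | add x y hx hy => simp [hx, hy]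
  rw [rightHit_apply, h, sliceRight, LinearMap.comp_apply, lTensor_counit_comul]
  simp

theorem leftHit_counit (x : C) : leftHit (counit (R := k)) x = x := by
  rw [leftHit_apply, sliceRight, LinearMap.comp_apply, lTensor_counit_comul]
  simp

theorem rightHit_counit (x : C) : rightHit (counit (R := k)) x = x := by
  rw [rightHit_apply, sliceLeft, LinearMap.comp_apply, rTensor_counit_comul]
  simp

/-- This is coassociativity: both sides are ∑ g(x₁) f(x₃) x₂. -/
theorem leftHit_rightHit (f g : C →ₗ[k] k) (x : C) :
    leftHit f (rightHit g x) = rightHit g (leftHit f x) := by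
  have h1 : ∀ z : C ⊗[k] C, leftHit f (sliceLeft C g z) =
      sliceRight C f (sliceLeft (C ⊗[k] C) g (comul.lTensor C z)) := by
    intro z
    induction z with
    | zero => simp
    | tmul x y => simp [leftHit_apply]
    | add x y hx hy => simp [hx, hy]
  have h2 : ∀ z : C ⊗[k] C, rightHit g (sliceRight C f z) =
      sliceRight C f (sliceLeft (C ⊗[k] C) g
        (TensorProduct.assoc k C C C (comul.rTensor C z))) := by
    intro z
    induction z with
    | zero => simp
    | tmul x y =>
      simp only [sliceRight_tmul, map_smul, rightHit_apply, LinearMap.rTensor_tmul]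
      generalize (comul x : C ⊗[k] C) = w
      induction w with
      | zero => simp
      | tmul a b => simpa using smul_comm _ _ _
      | add a b ha hb => simp [add_tmul, ha, hb]
    | add x y hx hy => simp [hx, hy]
  rw [rightHit_apply, h1, leftHit_apply, h2, coassoc_apply]

/-- For every functional φ, φ(T x) = ε(φ acting on the right on T x) = (ε ∘ T)(`rightHit φ x`) =
φ(`leftHit (ε ∘ T) x`). Thus the commutant of the right action is exactly the left action, which
replaces explicit use of the convolution algebra. -/
theorem eq_leftHit_of_commute {T : Module.End k C}
    (hT : ∀ (g : C →ₗ[k] k) (x : C), T (rightHit g x) = rightHit g (T x)) :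
    T = leftHit (counit ∘ₗ T) := by
  ext x
  rw [← sub_eq_zero, ← Module.forall_dual_apply_eq_zero_iff k]
  intro φ
  rw [map_sub, sub_eq_zero, ← counit_rightHit φ, ← counit_rightHit φ, ← leftHit_rightHit, ← hT,
    counit_leftHit]
  rfl

theorem eq_rightHit_of_commute {T : Module.End k C}
    (hT : ∀ (g : C →ₗ[k] k) (x : C), T (leftHit g x) = leftHit g (T x)) :
    T = rightHit (counit ∘ₗ T) := by
  ext x
  rw [← sub_eq_zero, ← Module.forall_dual_apply_eq_zero_iff k]
  intro φ
  rw [map_sub, sub_eq_zero, ← counit_leftHit φ, ← counit_leftHit φ, leftHit_rightHit, ← hT,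
    counit_rightHit]
  rfl

theorem leftHit_leftHit (f g : C →ₗ[k] k) (x : C) :
    leftHit f (leftHit g x) = leftHit (f ∘ₗ leftHit g) x := by
  have h := eq_leftHit_of_commute (T := leftHit f * leftHit g)
    (fun g x => by simp [leftHit_rightHit])
  refine (LinearMap.congr_fun h x).trans ?_
  congr 2
  ext y
  simp [counit_leftHit]

theorem rightHit_rightHit (f g : C →ₗ[k] k) (x : C) :
    rightHit f (rightHit g x) = rightHit (f ∘ₗ rightHit g) x := by
  have h := eq_rightHit_of_commute (T := rightHit f * rightHit g)
    (fun g x => by simp [leftHit_rightHit])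
  refine (LinearMap.congr_fun h x).trans ?_
  congr 2
  ext y
  simp [counit_rightHit]

/-- Every nonzero subcoalgebra contains a finite-dimensional nonzero subcoalgebra. -/
theorem IsSubcoalgebra.exists_finiteDimensional {D : Submodule k C} (hD : IsSubcoalgebra k D)
    (h : D ≠ ⊥) :
    ∃ E : Submodule k C, IsSubcoalgebra k E ∧ E ≤ D ∧ E ≠ ⊥ ∧ FiniteDimensional k E := by
  obtain ⟨x, hxD, hx⟩ := (Submodule.ne_bot_iff _).1 h
  rw [isSubcoalgebra_iff] at hD
  let E : Submodule k C := Submodule.span k {y | ∃ f g : C →ₗ[k] k, y = leftHit f (rightHit g x)}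
  refine ⟨E, ?_, ?_, ?_, ?_⟩
  · rw [isSubcoalgebra_iff]
    intro y hy f
    constructor
    · refine (Submodule.span_le.2 ?_ : E ≤ E.comap (leftHit f)) hy
      rintro _ ⟨g, h, rfl⟩
      exact Submodule.subset_span ⟨_, h, leftHit_leftHit _ _ _⟩
    · refine (Submodule.span_le.2 ?_ : E ≤ E.comap (rightHit f)) hy
      rintro _ ⟨g, h, rfl⟩
      refine Submodule.subset_span ⟨g, f ∘ₗ rightHit h, ?_⟩
      rw [← rightHit_rightHit]
      exact (leftHit_rightHit _ _ _).symm
  · refine Submodule.span_le.2 ?_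
    rintro _ ⟨f, g, rfl⟩
    exact (hD _ (hD _ hxD g).2 f).1
  · refine (Submodule.ne_bot_iff _).2 ⟨x, Submodule.subset_span ⟨counit, counit, ?_⟩, hx⟩
    rw [leftHit_counit, rightHit_counit]
  -- All right hits of x lie in a finite-dimensional U, and the left hits of each basis vector of U
  -- span a finite-dimensional space.
  · obtain ⟨U, hU, hxU⟩ := exists_finiteDimensional_sliceLeft (comul (R := k) x)
    have hW (y : C) : ∃ W : Submodule k C, FiniteDimensional k W ∧ ∀ f : C →ₗ[k] k,
        leftHit f y ∈ W :=
      exists_finiteDimensional_sliceRight (comul (R := k) y : C ⊗[k] C)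
    choose W hW hyW using hW
    let b := Module.finBasis k U
    have hle : E ≤ ⨆ i, W (b i : C) := by
      refine Submodule.span_le.2 ?_
      rintro _ ⟨f, g, rfl⟩
      have : rightHit g x = ∑ i, b.repr ⟨_, hxU g⟩ i • (b i : C) := by
        have := congrArg Subtype.val (b.sum_repr ⟨_, hxU g⟩)
        rw [← Submodule.subtype_apply, map_sum] at this
        exact this.symm
      rw [this, map_sum]
      refine Submodule.sum_mem _ fun i _ => ?_
      rw [map_smul]
      exact Submodule.smul_mem _ _ (Submodule.mem_iSup_of_mem i (hyW _ f))
    exact Submodule.finiteDimensional_of_le hle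

/-- Every nonzero subcoalgebra contains a simple subcoalgebra. -/
theorem IsSubcoalgebra.exists_isSimpleSubcoalgebra {D : Submodule k C} (hD : IsSubcoalgebra k D)
    (h : D ≠ ⊥) : ∃ E : Submodule k C, IsSimpleSubcoalgebra k E ∧ E ≤ D := by
  obtain ⟨F, hF, hFD, hF0, hFfin⟩ := hD.exists_finiteDimensional h
  let P : ℕ → Prop := fun n => ∃ E : Submodule k C, IsSubcoalgebra k E ∧ E ≤ D ∧ E ≠ ⊥ ∧
    FiniteDimensional k E ∧ Module.finrank k E = n
  classical
  have hP : ∃ n, P n := ⟨_, F, hF, hFD, hF0, hFfin, rfl⟩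
  obtain ⟨E, hE, hED, hE0, hEfin, hn⟩ := Nat.find_spec hP
  refine ⟨E, ⟨hE, hE0, fun E' hE' hle => ?_⟩, hED⟩
  by_contra! hcon
  have : Module.finrank k E' < Module.finrank k E :=
    Submodule.finrank_lt_finrank_of_lt (lt_of_le_of_ne hle hcon.2)
  rw [hn] at this
  exact Nat.find_min hP this ⟨E', hE', hle.trans hED, hcon.1,
    Submodule.finiteDimensional_of_le hle, rfl⟩

end Coalgebra

/-! ### Connectedness and primitive elements modulo a subcoalgebra -/

section Connected

variable {k : Type*} [Field k]

/-- Let `L` and `R` be the two actions of the dual of a coalgebra `V` with counit `ε` such that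
every nonzero bistable subspace contains the grouplike element `e`. Then every `L`-stable
subspace `N` not contained in an `L`-stable subspace `D` contains an `L`-coinvariant modulo `D`. -/
theorem exists_coinvariant_mod {V : Type*} [AddCommGroup V] [Module k V] (ε : V →ₗ[k] k)
    (L R : (V →ₗ[k] k) → Module.End k V) (e : V) (he : ε e = 1)
    (hLR : ∀ f g x, L f (R g x) = R g (L f x))
    (hL : ∀ T : Module.End k V, (∀ g x, T (R g x) = R g (T x)) → T = L (ε ∘ₗ T))
    (hεL : ∀ f x, ε (L f x) = f x) (hεR : ∀ f x, ε (R f x) = f x)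
    (hLe : ∀ f, L f e = f e • e)
    (hfin : ∀ x, ∃ W : Submodule k V, FiniteDimensional k W ∧ ∀ f, L f x ∈ W)
    (hconn : ∀ E : Submodule k V, (∀ x ∈ E, ∀ f, L f x ∈ E ∧ R f x ∈ E) → E ≠ ⊥ → e ∈ E)
    (D N : Submodule k V) (hD : ∀ x ∈ D, ∀ f, L f x ∈ D) (hN : ∀ x ∈ N, ∀ f, L f x ∈ N)
    (hDN : ¬ N ≤ D) :
    ∃ x ∈ N, x ∉ D ∧ ∀ f, L f x - f e • x ∈ D := by
  -- The commutant of the R-action; by `hL` it consists exactly of the operators L f.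
  let A : Subalgebra k (Module.End k V) := Subalgebra.centralizer k (Set.range R)
  have hAR : ∀ (T : A) g x, (T : Module.End k V) (R g x) = R g ((T : Module.End k V) x) := by
    intro T g x
    exact (LinearMap.congr_fun (Subalgebra.mem_centralizer_iff k |>.1 T.2 _ ⟨g, rfl⟩) x).symm
  have hAL : ∀ T : A, (T : Module.End k V) = L (ε ∘ₗ (T : Module.End k V)) :=
    fun T => hL _ (hAR T)
  have hLA : ∀ f, L f ∈ A := by
    intro f
    rw [Subalgebra.mem_centralizer_iff]
    rintro _ ⟨g, rfl⟩
    ext x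
    exact (hLR f g x).symm
  have hstab : ∀ U : Submodule k V, (∀ x ∈ U, ∀ f, L f x ∈ U) → ∀ (T : A) x, x ∈ U →
      (T : Module.End k V) x ∈ U := by
    intro U hU T x hx
    rw [hAL T]
    exact hU x hx _
  have hTe : ∀ T : A, (T : Module.End k V) e = ε ((T : Module.End k V) e) • e := by
    intro T
    conv_lhs => rw [hAL T, hLe]
    rfl
  let χ : A →ₐ[k] k := AlgHom.ofLinearMap
    (ε ∘ₗ LinearMap.applyₗ e ∘ₗ A.val.toLinearMap) (by simpa using he) (by
      intro T T'
      simp only [LinearMap.comp_apply, AlgHom.toLinearMap_apply, Subalgebra.coe_val,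
        LinearMap.applyₗ_apply_apply, MulMemClass.coe_mul, Module.End.mul_apply]
      conv_lhs => rw [hTe T', map_smul, map_smul, smul_eq_mul]
      exact mul_comm _ _)
  have hχ : ∀ T : A, χ T = ε ((T : Module.End k V) e) := fun T => rfl
  let D' : Submodule A V := { D with smul_mem' := fun T x hx => hstab D hD T x hx }
  let N' : Submodule A V := { N with smul_mem' := fun T x hx => hstab N hN T x hx }
  obtain ⟨x, hxN, hxD, hx⟩ := exists_eigenvector_mod χ (by
    intro x
    obtain ⟨W, hW, hWx⟩ := hfin x
    refine ⟨W, hW, fun T => ?_⟩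
    have : (T : Module.End k V) x ∈ W := by
      rw [hAL T]
      exact hWx _
    exact this) D' N' hDN (by
    intro a x hx hax
    -- The orthogonal, under (T, y) ↦ ε(T y), of the ideal of operators sending the cyclic module A
    -- x into D. It is bistable, so once nonzero it contains e, and pairing a with e gives χ a = 0.
    let E : Submodule k V :=
      { carrier := {y | ∀ T : A, (∀ b : A, T • b • x ∈ D) → ε (T • y) = 0}
        add_mem' := fun {y z} hy hz T hT => by rw [smul_add, map_add, hy T hT, hz T hT, add_zero]
        zero_mem' := fun T _ => by rw [smul_zero, map_zero]
        smul_mem' := fun c y hy T hT => by rw [smul_comm, map_smul, hy T hT, smul_zero] }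
    have heE : e ∈ E := by
      refine hconn E ?_ ?_
      · intro y hy f
        have hLf : ∀ T : A, (∀ b : A, T • b • x ∈ D) → ε (T • L f y) = 0 := by
          intro T hT
          refine (hy (T * ⟨L f, hLA f⟩) fun b => ?_ :)
          have := hT (⟨L f, hLA f⟩ * b)
          rwa [mul_smul] at this ⊢
        refine ⟨hLf, fun T hT => ?_⟩
        have h1 : ε (T • R f y) = ε ((⟨L f, hLA f⟩ * T : A) • y) := by
          have h2 : T • R f y = R f (T • y) := hAR T f y
          rw [h2, hεR, mul_smul, ← hεL f]
          rfl
        rw [h1]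
        refine hy _ fun b => ?_
        rw [mul_smul]
        exact hD _ (hT b) f
      -- A functional φ vanishing on D but not at x gives R φ x ∈ E, since ε(T (R φ x)) = φ(T x).
      · obtain ⟨φ, hφx, hφD⟩ :=
          Submodule.exists_dual_map_eq_bot_of_notMem (p := D) hx inferInstance
        have hφ : ∀ z ∈ D, φ z = 0 := by
          intro z hz
          have : φ z ∈ D.map φ := ⟨z, hz, rfl⟩
          rwa [hφD, Submodule.mem_bot] at this
        refine (Submodule.ne_bot_iff _).2 ⟨R φ x, fun T hT => ?_, fun h0 => hφx ?_⟩
        · have h2 : T • R φ x = R φ (T • x) := hAR T φ x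
          rw [h2, hεR]
          exact hφ _ (by simpa using hT 1)
        · rw [← hεR, h0, map_zero]
    exact heE a hax)
  refine ⟨x, hxN, hxD, fun f => ?_⟩
  have hf : χ ⟨L f, hLA f⟩ = f e := by rw [hχ]; simp [hLe, he]
  rw [← hf]
  exact hx ⟨L f, hLA f⟩

variable {H : Type*} [CommRing H] [HopfAlgebra k H]

open Coalgebra

theorem leftHit_one (f : H →ₗ[k] k) : leftHit f 1 = f 1 • (1 : H) := by
  rw [leftHit_apply, Bialgebra.comul_one, Algebra.TensorProduct.one_def, sliceRight_tmul]

theorem rightHit_one (f : H →ₗ[k] k) : rightHit f 1 = f 1 • (1 : H) := by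
  rw [rightHit_apply, Bialgebra.comul_one, Algebra.TensorProduct.one_def, sliceLeft_tmul]

/-- Every nonzero subcoalgebra of a connected Hopf algebra contains `1`. -/
theorem IsConnectedHopfAlgebra.one_mem (hH : IsConnectedHopfAlgebra k H) {D : Submodule k H}
    (hD : IsSubcoalgebra k D) (h : D ≠ ⊥) : 1 ∈ D := by
  have h1 : (1 : H) ≠ 0 := by
    intro h0
    have := congrArg (counit (R := k)) h0
    simp at this
  have hatom : IsAtom (k ∙ (1 : H)) := nonzero_span_atom _ h1
  have hs : IsSimpleSubcoalgebra k (k ∙ (1 : H)) := by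
    refine ⟨isSubcoalgebra_iff.2 ?_, hatom.1, fun E _ hE => hatom.le_iff.1 hE⟩
    intro x hx f
    obtain ⟨c, rfl⟩ := Submodule.mem_span_singleton.1 hx
    rw [map_smul, map_smul, leftHit_one, rightHit_one]
    have := (k ∙ (1 : H)).smul_mem c ((k ∙ (1 : H)).smul_mem (f 1)
      (Submodule.mem_span_singleton_self _))
    exact ⟨this, this⟩
  have hcor : k ∙ (1 : H) = coradical k H := by
    have hf : Module.finrank k (coradical k H) = 1 := hH
    have : FiniteDimensional k (coradical k H) := Module.finite_of_finrank_eq_succ hf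
    refine Submodule.eq_of_le_of_finrank_eq (le_sSup hs) ?_
    rw [hf, finrank_span_singleton h1]
  obtain ⟨E, hE, hED⟩ := hD.exists_isSimpleSubcoalgebra h
  have hle : E ≤ k ∙ (1 : H) := hcor ▸ le_sSup hE
  rw [(hatom.le_iff.1 hle).resolve_left hE.ne_bot] at hED
  exact hED (Submodule.mem_span_singleton_self _)

/-- A proper subcoalgebra of a connected Hopf algebra containing `1` admits an element
outside of it which is primitive modulo it. -/
theorem IsConnectedHopfAlgebra.exists_primitive_mod (hH : IsConnectedHopfAlgebra k H)
    {D : Submodule k H} (hD : IsSubcoalgebra k D) (h1 : 1 ∈ D) (hne : D ≠ ⊤) :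
    ∃ x ∉ D, comul (R := k) x - x ⊗ₜ 1 - 1 ⊗ₜ x ∈
      LinearMap.range (TensorProduct.map D.subtype D.subtype) := by
  have hD' := isSubcoalgebra_iff.1 hD
  have hε : counit (R := k) (1 : H) = 1 := Bialgebra.counit_one
  obtain ⟨y, -, hyD, hy⟩ := exists_coinvariant_mod (counit (R := k)) leftHit rightHit (1 : H) hε
    leftHit_rightHit (fun T => eq_leftHit_of_commute) counit_leftHit counit_rightHit
    leftHit_one
    (fun x => exists_finiteDimensional_sliceRight (comul (R := k) x : H ⊗[k] H))
    (fun E hE hE0 => hH.one_mem (isSubcoalgebra_iff.2 hE) hE0) D ⊤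
    (fun x hx f => (hD' x hx f).1) (fun _ _ _ => trivial) (fun h => hne (top_le_iff.1 h))
  -- The coinvariants modulo D on one side. They are stable under the other action, so the mirrored
  -- argument can be run inside N.
  let N : Submodule k H := ⨅ f : H →ₗ[k] k, D.comap (leftHit f - f 1 • LinearMap.id)
  have hN : ∀ x, x ∈ N ↔ ∀ f : H →ₗ[k] k, leftHit f x - f 1 • x ∈ D := by
    intro x
    simp [N, Submodule.mem_iInf]
  obtain ⟨x, hxN, hxD, hx⟩ := exists_coinvariant_mod (counit (R := k)) rightHit leftHit (1 : H) hε
    (fun f g x => (leftHit_rightHit g f x).symm) (fun T => eq_rightHit_of_commute)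
    counit_rightHit counit_leftHit rightHit_one
    (fun x => exists_finiteDimensional_sliceLeft (comul (R := k) x : H ⊗[k] H))
    (fun E hE hE0 => hH.one_mem (isSubcoalgebra_iff.2 fun x hx f => (hE x hx f).symm) hE0) D N
    (fun x hx f => (hD' x hx f).2) (by
      intro x hx g
      rw [hN] at hx ⊢
      intro f
      rw [leftHit_rightHit, ← map_smul, ← map_sub]
      exact (hD' _ (hx f) g).2) (fun h => hyD (h ((hN y).2 hy)))
  refine ⟨x, hxD, mem_range_map_subtype_iff.2 ⟨fun f => ?_, fun f => ?_⟩⟩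
  · rw [map_sub, map_sub, ← leftHit_apply, sliceRight_tmul, sliceRight_tmul]
    exact D.sub_mem ((hN x).1 hxN f) (D.smul_mem _ h1)
  · rw [map_sub, map_sub, ← rightHit_apply, sliceLeft_tmul, sliceLeft_tmul, sub_right_comm]
    exact D.sub_mem (hx f) (D.smul_mem _ h1)

end Connected

/-! ### Transcendence of elements primitive modulo a Hopf subalgebra -/

section Transcendence

open Coalgebra

variable {k : Type*} [Field k] {H : Type*} [CommRing H] [HopfAlgebra k H]

theorem sliceRight_mul_tmul_one (f : H →ₗ[k] k) (z : H ⊗[k] H) (c : H) :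
    sliceRight H f (z * c ⊗ₜ 1) = sliceRight H f z * c := by
  induction z with
  | zero => simp
  | tmul x y => simp
  | add x y hx hy => simp [add_mul, hx, hy]

theorem sliceRight_tmul_mul (f : H →ₗ[k] k) (z : H ⊗[k] H) (a b : H) :
    sliceRight H f (a ⊗ₜ b * z) = a * sliceRight H (f ∘ₗ LinearMap.mulLeft k b) z := by
  induction z with
  | zero => simp
  | tmul x y => simp
  | add x y hx hy => simp [mul_add, hx, hy]

/-- A nonzero ideal of a Hopf subalgebra `E` which is a right coideal contains `1`. -/
theorem IsHopfSubalgebra.one_mem_of_ideal {E : Subalgebra k H} (hE : IsHopfSubalgebra E)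
    {I : Submodule k H} (hIE : I ≤ Subalgebra.toSubmodule E)
    (hmul : ∀ a ∈ I, ∀ b ∈ E, a * b ∈ I) (hcoideal : ∀ a ∈ I, ∀ f : H →ₗ[k] k, leftHit f a ∈ I)
    (hne : I ≠ ⊥) : (1 : H) ∈ I := by
  have hΔ : ∀ a ∈ I, comul (R := k) a ∈
      LinearMap.range (TensorProduct.map I.subtype (Subalgebra.toSubmodule E).subtype) :=
    fun a ha => mem_range_map_subtype_iff.2
      ⟨hcoideal a ha, fun f => (isSubcoalgebra_iff.1 hE.isSubcoalgebra a (hIE ha) f).2⟩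
  -- ε(a)·1 = ∑ a₁ S(a₂), with a₁ ∈ I and S(a₂) ∈ E.
  have hmem : ∀ a ∈ I, algebraMap k H (counit a) ∈ I := by
    intro a ha
    rw [← HopfAlgebra.mul_antipode_lTensor_comul_apply]
    obtain ⟨z, hz⟩ := hΔ a ha
    rw [← hz]
    clear hz
    induction z with
    | zero => simp
    | tmul x y => simpa using hmul _ x.2 _ (hE.antipode_mem _ y.2)
    | add x y hx hy => simpa using I.add_mem hx hy
  obtain ⟨a, ha, ha0⟩ : ∃ a ∈ I, counit (R := k) a ≠ 0 := by
    by_contra! hcon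
    refine hne ((Submodule.eq_bot_iff _).2 fun a ha => ?_)
    obtain ⟨z, hz⟩ := hΔ a ha
    rw [← rightHit_counit (k := k) a, rightHit_apply, ← hz]
    clear hz
    induction z with
    | zero => simp
    | tmul x y => simp [hcon _ x.2]
    | add x y hx hy => simp [hx, hy]
  have := I.smul_mem (counit (R := k) a)⁻¹ (hmem a ha)
  rwa [Algebra.algebraMap_eq_smul_one, smul_smul, inv_mul_cancel₀ ha0, one_smul] at this

variable (E : Subalgebra k H)

/-- The `E`-submodule generated by the powers `x ^ i` with `i < d`. -/
def spanPowersLT (x : H) (d : ℕ) : Submodule E H :=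
  Submodule.span E ((fun i => x ^ i) '' Set.Iio d)

/-- The tensors all of whose slices in the first factor lie in `M`. -/
noncomputable def slicesIn {E : Subalgebra k H} (M : Submodule E H) : Submodule k (H ⊗[k] H) :=
  ⨅ f : H →ₗ[k] k, (M.restrictScalars k).comap (sliceRight H f)

variable {E}

theorem mem_slicesIn {M : Submodule E H} {z : H ⊗[k] H} :
    z ∈ slicesIn M ↔ ∀ f : H →ₗ[k] k, sliceRight H f z ∈ M := by
  simp [slicesIn, Submodule.mem_iInf]

theorem tmul_mem_slicesIn {M : Submodule E H} {a : H} (ha : a ∈ M) (b : H) :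
    a ⊗ₜ[k] b ∈ slicesIn M := by
  rw [mem_slicesIn]
  intro f
  rw [sliceRight_tmul]
  exact (M.restrictScalars k).smul_mem _ ha

/-- Left multiplication by b in the second factor is absorbed into the functional, so only the
E-module structure of M is needed. -/
theorem mul_mem_slicesIn {M : Submodule E H} {y z : H ⊗[k] H}
    (hy : y ∈ (Algebra.TensorProduct.map E.val (AlgHom.id k H)).range) (hz : z ∈ slicesIn M) :
    y * z ∈ slicesIn M := by
  obtain ⟨y, rfl⟩ := hy
  change Algebra.TensorProduct.map E.val (AlgHom.id k H) y * z ∈ _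
  induction y with
  | zero => simp
  | tmul a b =>
    rw [mem_slicesIn] at hz ⊢
    intro f
    rw [Algebra.TensorProduct.map_tmul, sliceRight_tmul_mul]
    exact M.smul_mem a (hz _)
  | add x y hx hy => simpa [add_mul] using Submodule.add_mem _ hx hy

theorem sliceRight_mem_of_mem_range {y : H ⊗[k] H}
    (hy : y ∈ (Algebra.TensorProduct.map E.val (AlgHom.id k H)).range) (f : H →ₗ[k] k) :
    sliceRight H f y ∈ E := by
  obtain ⟨y, rfl⟩ := hy
  change sliceRight H f (Algebra.TensorProduct.map E.val (AlgHom.id k H) y) ∈ _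
  induction y with
  | zero => simp
  | tmul a b => simpa using E.smul_mem a.2 (f b)
  | add x y hx hy => simpa using E.add_mem hx hy

theorem mem_range_map_val_of_mem {y : H ⊗[k] H}
    (hy : y ∈ LinearMap.range (TensorProduct.map (Subalgebra.toSubmodule E).subtype
      (Subalgebra.toSubmodule E).subtype)) :
    y ∈ (Algebra.TensorProduct.map E.val (AlgHom.id k H)).range := by
  obtain ⟨z, rfl⟩ := hy
  induction z with
  | zero => simp
  | tmul a b => exact ⟨(⟨a.1, a.2⟩ : E) ⊗ₜ b.1, by simp⟩
  | add x y hx hy => simpa using Subalgebra.add_mem _ hx hy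

theorem pow_mem_spanPowersLT (x : H) {i d : ℕ} (h : i < d) : x ^ i ∈ spanPowersLT E x d :=
  Submodule.subset_span ⟨i, h, rfl⟩

theorem mul_pow_mem_slicesIn {x : H} {y : H ⊗[k] H} {i d : ℕ} (h : i < d)
    (hy : y ∈ (Algebra.TensorProduct.map E.val (AlgHom.id k H)).range) :
    y * (x ⊗ₜ[k] 1) ^ i ∈ slicesIn (spanPowersLT E x d) := by
  refine mul_mem_slicesIn hy ?_
  rw [Algebra.TensorProduct.tmul_pow]
  exact tmul_mem_slicesIn (pow_mem_spanPowersLT x h) _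

theorem add_pow_mem_slicesIn {x : H} {w : H ⊗[k] H} {n d : ℕ} (h : n < d)
    (hw : w ∈ (Algebra.TensorProduct.map E.val (AlgHom.id k H)).range) :
    (x ⊗ₜ[k] 1 + w) ^ n ∈ slicesIn (spanPowersLT E x d) := by
  rw [add_pow]
  refine Submodule.sum_mem _ fun i hi => ?_
  rw [mul_assoc, mul_comm]
  exact mul_pow_mem_slicesIn (by simp at hi; omega) (mul_mem (pow_mem hw _) (natCast_mem _ _))

theorem add_pow_sub_pow_mem_slicesIn {x : H} {w : H ⊗[k] H} (n : ℕ)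
    (hw : w ∈ (Algebra.TensorProduct.map E.val (AlgHom.id k H)).range) :
    (x ⊗ₜ[k] 1 + w) ^ n - (x ⊗ₜ[k] 1) ^ n ∈ slicesIn (spanPowersLT E x n) := by
  rw [add_pow, Finset.sum_range_succ]
  simp only [Nat.sub_self, pow_zero, mul_one, Nat.choose_self, Nat.cast_one, add_sub_cancel_right]
  refine Submodule.sum_mem _ fun i hi => ?_
  rw [mul_assoc, mul_comm]
  exact mul_pow_mem_slicesIn (by simpa using hi) (mul_mem (pow_mem hw _) (natCast_mem _ _))

theorem add_pow_succ_sub_mem_slicesIn {x : H} {w : H ⊗[k] H} (n : ℕ)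
    (hw : w ∈ (Algebra.TensorProduct.map E.val (AlgHom.id k H)).range) :
    (x ⊗ₜ[k] 1 + w) ^ (n + 1) - (x ⊗ₜ[k] 1) ^ (n + 1) -
        ((n + 1 : ℕ) : H ⊗[k] H) * w * (x ⊗ₜ[k] 1) ^ n ∈
      slicesIn (spanPowersLT E x n) := by
  rw [add_pow, Finset.sum_range_succ, Finset.sum_range_succ]
  have : ∀ a b c : H ⊗[k] H, a + b + c - c - b = a := fun a b c => by ring
  have h2 : (x ⊗ₜ[k] (1 : H)) ^ n * w ^ (n + 1 - n) * ((n + 1).choose n : H ⊗[k] H) =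
      ((n + 1 : ℕ) : H ⊗[k] H) * w * (x ⊗ₜ[k] 1) ^ n := by
    rw [Nat.add_sub_cancel_left, Nat.choose_succ_self_right]; ring
  rw [h2]
  simp only [Nat.sub_self, pow_zero, mul_one, Nat.choose_self, Nat.cast_one, this]
  refine Submodule.sum_mem _ fun i hi => ?_
  rw [mul_assoc, mul_comm]
  exact mul_pow_mem_slicesIn (by simpa using hi) (mul_mem (pow_mem hw _) (natCast_mem _ _))

theorem comul_mem_range_map_val (hE : IsSubcoalgebra k (Subalgebra.toSubmodule E)) {c : H}
    (hc : c ∈ E) :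
    comul (R := k) c ∈ (Algebra.TensorProduct.map E.val (AlgHom.id k H)).range :=
  mem_range_map_val_of_mem (hE c hc)

/-- Δ respects degree in x: w acts as a coefficient in E⊗H, so Δ(x) is a degree one polynomial in
x⊗1. -/
theorem comul_mem_slicesIn (hE : IsSubcoalgebra k (Subalgebra.toSubmodule E)) {x : H}
    {w : H ⊗[k] H} (hw : w ∈ (Algebra.TensorProduct.map E.val (AlgHom.id k H)).range)
    (hx : comul (R := k) x = x ⊗ₜ 1 + w) {d : ℕ} {m : H} (hm : m ∈ spanPowersLT E x d) :
    comul (R := k) m ∈ slicesIn (spanPowersLT E x d) := by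
  induction hm using Submodule.span_induction with
  | mem y hy =>
    obtain ⟨i, hi, rfl⟩ := hy
    rw [Bialgebra.comul_pow, hx]
    exact add_pow_mem_slicesIn hi hw
  | zero => simp
  | add y z _ _ hy hz => rw [map_add]; exact Submodule.add_mem _ hy hz
  | smul c y _ hy =>
    rw [Subalgebra.smul_def, smul_eq_mul, Bialgebra.comul_mul]
    exact mul_mem_slicesIn (comul_mem_range_map_val hE c.2) hy

/-- If `x` is primitive modulo a Hopf subalgebra `E` which does not contain `x`, then in
characteristic zero no nonzero multiple of `x ^ d` is a combination of lower powers of `x`. -/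
theorem eq_zero_of_mul_pow_mem_spanPowersLT [CharZero k] (hE : IsHopfSubalgebra E) {x : H}
    (hxE : x ∉ E) {u : H ⊗[k] H}
    (hu : u ∈ LinearMap.range (TensorProduct.map (Subalgebra.toSubmodule E).subtype
      (Subalgebra.toSubmodule E).subtype))
    (hx : comul (R := k) x = x ⊗ₜ 1 + (1 ⊗ₜ x + u)) (d : ℕ) :
    ∀ a ∈ E, a * x ^ d ∈ spanPowersLT E x d → a = 0 := by
  have hw : 1 ⊗ₜ x + u ∈ (Algebra.TensorProduct.map E.val (AlgHom.id k H)).range :=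
    add_mem ⟨1 ⊗ₜ x, by simp⟩ (mem_range_map_val_of_mem hu)
  set w : H ⊗[k] H := 1 ⊗ₜ x + u with hwdef
  induction d using Nat.strong_induction_on with
  | _ d ih =>
  by_contra! hcon
  obtain ⟨a, haE, ha, ha0⟩ := hcon
  -- The ideal of leading coefficients of relations of degree at most d.
  let I : Submodule k H :=
    { carrier := {a | a ∈ E ∧ a * x ^ d ∈ spanPowersLT E x d}
      add_mem' := fun {a b} ha hb => ⟨add_mem ha.1 hb.1, by
        rw [add_mul]; exact add_mem ha.2 hb.2⟩
      zero_mem' := ⟨zero_mem _, by simp⟩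
      smul_mem' := fun c a ha => ⟨E.smul_mem ha.1 c, by
        rw [smul_mul_assoc]; exact ((spanPowersLT E x d).restrictScalars k).smul_mem c ha.2⟩ }
  have h1 : (1 : H) ∈ I := by
    refine hE.one_mem_of_ideal (fun a ha => ha.1) (fun a ha b hb => ⟨mul_mem ha.1 hb, ?_⟩)
      (fun a ha f => ⟨(isSubcoalgebra_iff.1 hE.isSubcoalgebra a ha.1 f).1, ?_⟩)
      ((Submodule.ne_bot_iff _).2 ⟨a, ⟨haE, ha⟩, ha0⟩)
    · rw [mul_right_comm, mul_comm]
      exact (spanPowersLT E x d).smul_mem ⟨b, hb⟩ ha.2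
    · rw [leftHit_apply, ← sliceRight_mul_tmul_one]
      refine mem_slicesIn.1 ?_ f
      -- Δ(a)(x⊗1)^d is Δ(a x^d) minus Δ(a)((x⊗1 + w)^d − (x⊗1)^d), and both terms have degree less
      -- than d.
      have e1 := comul_mem_slicesIn hE.isSubcoalgebra hw hx ha.2
      have e2 := mul_mem_slicesIn (comul_mem_range_map_val hE.isSubcoalgebra ha.1)
        (add_pow_sub_pow_mem_slicesIn (x := x) d hw)
      rw [Bialgebra.comul_mul, Bialgebra.comul_pow, hx] at e1
      have := Submodule.sub_mem _ e1 e2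
      rw [← mul_sub, sub_sub_cancel, Algebra.TensorProduct.tmul_pow, one_pow] at this
      exact this
  have hxd := h1.2
  rw [one_mul] at hxd
  cases d with
  | zero =>
    simp only [spanPowersLT, pow_zero] at hxd
    have h0 : (Set.Iio 0 : Set ℕ) = ∅ := by ext; simp
    rw [h0, Set.image_empty, Submodule.span_empty, Submodule.mem_bot] at hxd
    exact ha0 (by rw [← mul_one a, hxd, mul_zero])
  | succ e =>
    have hI : (Set.Iio (e + 1) : Set ℕ) = insert e (Set.Iio e) := by ext; simp
    rw [spanPowersLT, hI, Set.image_insert_eq, Submodule.mem_span_insert] at hxd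
    obtain ⟨c, m, hm, hcm⟩ := hxd
    rw [Subalgebra.smul_def, smul_eq_mul] at hcm
    -- The coefficient of (x⊗1)^e in Δ applied to x^(e+1) = c x^e + m, after subtracting that
    -- relation tensored with 1.
    let y : H ⊗[k] H := (c : H) ⊗ₜ 1 + ((e + 1 : ℕ) : H ⊗[k] H) * w - comul (R := k) (c : H)
    have hcr : (c : H) ⊗ₜ[k] (1 : H) ∈
        (Algebra.TensorProduct.map E.val (AlgHom.id k H)).range := ⟨c ⊗ₜ 1, by simp⟩
    have hΔc := comul_mem_range_map_val hE.isSubcoalgebra c.2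
    have hy : y ∈ (Algebra.TensorProduct.map E.val (AlgHom.id k H)).range :=
      sub_mem (add_mem hcr (mul_mem (natCast_mem _ _) hw)) hΔc
    have hyx : y * (x ⊗ₜ[k] 1) ^ e ∈ slicesIn (spanPowersLT E x e) := by
      have t0 := comul_mem_slicesIn hE.isSubcoalgebra hw hx hm
      have t1 := add_pow_succ_sub_mem_slicesIn (x := x) e hw
      have t2 := mul_mem_slicesIn hΔc (add_pow_sub_pow_mem_slicesIn (x := x) e hw)
      have t3 := tmul_mem_slicesIn (k := k) hm (1 : H)
      have e0 := congrArg (comul (R := k)) hcm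
      rw [map_add, Bialgebra.comul_mul, Bialgebra.comul_pow, Bialgebra.comul_pow, hx] at e0
      have e1 := congrArg (fun z => z ⊗ₜ[k] (1 : H)) hcm
      have e2 : ∀ n, (x ⊗ₜ[k] (1 : H)) ^ n = (x ^ n) ⊗ₜ 1 := fun n => by
        rw [Algebra.TensorProduct.tmul_pow, one_pow]
      have e3 : (c * x ^ e) ⊗ₜ[k] (1 : H) = (c : H) ⊗ₜ 1 * (x ⊗ₜ[k] (1 : H)) ^ e := by
        rw [e2, Algebra.TensorProduct.tmul_mul_tmul, one_mul]
      simp only [add_tmul, ← e2, e3] at e1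
      have := Submodule.add_mem _ (Submodule.sub_mem _ (Submodule.sub_mem _ t0 t1) t3) t2
      convert this using 1
      linear_combination e0 - e1
    have hy0 : y = 0 := by
      refine eq_zero_of_sliceRight fun f => ?_
      refine ih e (Nat.lt_succ_self e) _ (sliceRight_mem_of_mem_range hy f) ?_
      have := mem_slicesIn.1 hyx f
      rwa [Algebra.TensorProduct.tmul_pow, one_pow, sliceRight_mul_tmul_one] at this
    -- Applying ε⊗id to y = 0 expresses (e + 1)x through c, ε(c) and a slice of u, all in E.
    have hs := congrArg (sliceLeft H (counit (R := k))) hy0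
    have hΔc' : sliceLeft H (counit (R := k)) (comul (R := k) (c : H)) = c :=
      rightHit_counit (k := k) (c : H)
    rw [map_zero, map_sub, map_add, sliceLeft_tmul, hΔc', ← nsmul_eq_mul, map_nsmul, hwdef,
      map_add, sliceLeft_tmul, Bialgebra.counit_one, one_smul] at hs
    have huE : sliceLeft H (counit (R := k)) u ∈ E := (mem_range_map_subtype_iff.1 hu).2 _
    have hmem : ((e + 1 : ℕ) : k) • x ∈ E := by
      have : ((e + 1 : ℕ) : k) • x = c - counit (R := k) (c : H) • (1 : H) -
          ((e + 1 : ℕ) : k) • sliceLeft H (counit (R := k)) u := by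
        rw [← Nat.cast_smul_eq_nsmul k, smul_add] at hs
        linear_combination hs
      rw [this]
      exact sub_mem (sub_mem c.2 (E.smul_mem E.one_mem _)) (E.smul_mem huE _)
    refine hxE ?_
    have := E.smul_mem hmem ((e + 1 : ℕ) : k)⁻¹
    rwa [smul_smul, inv_mul_cancel₀ (Nat.cast_ne_zero.2 e.succ_ne_zero), one_smul] at this

/-- An element which is primitive modulo a Hopf subalgebra not containing it is transcendental
over this subalgebra in characteristic zero. -/
theorem IsHopfSubalgebra.transcendental [CharZero k] (hE : IsHopfSubalgebra E) {x : H}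
    (hxE : x ∉ E)
    (hx : comul (R := k) x - x ⊗ₜ 1 - 1 ⊗ₜ x ∈ LinearMap.range (TensorProduct.map
      (Subalgebra.toSubmodule E).subtype (Subalgebra.toSubmodule E).subtype)) :
    Transcendental E x := by
  rw [transcendental_iff]
  intro p hp
  by_contra hp0
  refine hp0 (Polynomial.leadingCoeff_eq_zero.1 (Subtype.ext ?_))
  refine eq_zero_of_mul_pow_mem_spanPowersLT hE hxE hx (by ring) p.natDegree _
    p.leadingCoeff.2 ?_
  rw [Polynomial.aeval_eq_sum_range, Finset.sum_range_succ] at hp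
  have : (p.leadingCoeff : H) * x ^ p.natDegree =
      -∑ i ∈ Finset.range p.natDegree, p.coeff i • x ^ i := by
    rw [eq_neg_iff_add_eq_zero, add_comm]
    exact hp
  rw [this]
  refine Submodule.neg_mem _ (Submodule.sum_mem _ fun i hi => ?_)
  exact Submodule.smul_mem _ _ (pow_mem_spanPowersLT x (Finset.mem_range.1 hi))

end Transcendence

/-! ### Adjoining elements and Zorn's lemma -/

section Adjoin

open Coalgebra

variable {k : Type*} [Field k] {H : Type*} [CommRing H] [HopfAlgebra k H]

theorem mem_range_map_subtype_mono {D D' : Subalgebra k H} (h : D ≤ D') {z : H ⊗[k] H}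
    (hz : z ∈ LinearMap.range (TensorProduct.map (Subalgebra.toSubmodule D).subtype
      (Subalgebra.toSubmodule D).subtype)) :
    z ∈ LinearMap.range (TensorProduct.map (Subalgebra.toSubmodule D').subtype
      (Subalgebra.toSubmodule D').subtype) := by
  rw [mem_range_map_subtype_iff] at hz ⊢
  exact ⟨fun f => h (hz.1 f), fun f => h (hz.2 f)⟩

theorem mem_range_map_val_iff {E : Subalgebra k H} {z : H ⊗[k] H} :
    z ∈ (Algebra.TensorProduct.map E.val E.val).range ↔
      z ∈ LinearMap.range (TensorProduct.map (Subalgebra.toSubmodule E).subtype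
        (Subalgebra.toSubmodule E).subtype) :=
  Iff.rfl

/-- The antipode of an element which is primitive modulo a subalgebra `E` stable under the
antipode. -/
theorem antipode_add_mem {E : Subalgebra k H} (hE : IsHopfSubalgebra E) {x : H}
    (hx : comul (R := k) x - x ⊗ₜ 1 - 1 ⊗ₜ x ∈ LinearMap.range (TensorProduct.map
      (Subalgebra.toSubmodule E).subtype (Subalgebra.toSubmodule E).subtype)) :
    HopfAlgebra.antipode k x + x ∈ E := by
  have key : ∀ u ∈ LinearMap.range (TensorProduct.map (Subalgebra.toSubmodule E).subtype
      (Subalgebra.toSubmodule E).subtype),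
      LinearMap.mul' k H ((HopfAlgebra.antipode k).lTensor H u) ∈ E := by
    rintro _ ⟨z, rfl⟩
    induction z with
    | zero => simp
    | tmul a b => simpa using E.mul_mem a.2 (hE.antipode_mem _ b.2)
    | add a b ha hb => simpa using add_mem ha hb
  -- Multiplying out after id⊗S turns Δx − x⊗1 − 1⊗x into ε(x) − x − S(x).
  have h := key _ hx
  rw [map_sub, map_sub, map_sub, map_sub, HopfAlgebra.mul_antipode_lTensor_comul_apply] at h
  simp only [LinearMap.lTensor_tmul, LinearMap.mul'_apply, HopfAlgebra.antipode_one, mul_one,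
    one_mul] at h
  have := sub_mem (E.algebraMap_mem (counit (R := k) x)) h
  convert this using 1
  ring

/-- Δ is multiplicative, and so is the antipode because H is commutative; hence generators suffice.
-/
theorem isHopfSubalgebra_adjoin {K : Subalgebra k H} (hK : IsHopfSubalgebra K) (s : Set H)
    (hs : ∀ x ∈ s, comul (R := k) x ∈ LinearMap.range (TensorProduct.map
      (Subalgebra.toSubmodule ((Algebra.adjoin K s).restrictScalars k)).subtype
      (Subalgebra.toSubmodule ((Algebra.adjoin K s).restrictScalars k)).subtype))
    (hs' : ∀ x ∈ s, HopfAlgebra.antipode k x ∈ Algebra.adjoin K s) :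
    IsHopfSubalgebra ((Algebra.adjoin K s).restrictScalars k) := by
  set F := (Algebra.adjoin K s).restrictScalars k with hF
  have hKF : K ≤ F := fun x hx => (Algebra.adjoin K s).algebraMap_mem ⟨x, hx⟩
  constructor
  · intro x hx
    rw [← mem_range_map_val_iff]
    replace hx : x ∈ Algebra.adjoin K s := hx
    induction hx using Algebra.adjoin_induction with
    | mem x hx => exact hs x hx
    | algebraMap r => exact mem_range_map_subtype_mono hKF (hK.isSubcoalgebra _ r.2)
    | add x y _ _ hx hy => rw [map_add]; exact add_mem hx hy
    | mul x y _ _ hx hy => rw [Bialgebra.comul_mul]; exact mul_mem hx hy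
  · intro x hx
    replace hx : x ∈ Algebra.adjoin K s := hx
    induction hx using Algebra.adjoin_induction with
    | mem x hx => exact hs' x hx
    | algebraMap r => exact hKF (hK.antipode_mem _ r.2)
    | add x y _ _ hx hy => rw [map_add]; exact add_mem hx hy
    | mul x y _ _ hx hy =>
      rw [HopfAlgebra.antipode_mul_distrib]
      exact mul_mem hx hy

theorem mem_restrictScalars_adjoin (K : Subalgebra k H) {s : Set H} {x : H} (hx : x ∈ s) :
    x ∈ (Algebra.adjoin K s).restrictScalars k :=
  (Subalgebra.mem_restrictScalars k).2 (Algebra.subset_adjoin hx)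

theorem restrictScalars_adjoin_mono (K : Subalgebra k H) {s t : Set H} (h : s ⊆ t) :
    (Algebra.adjoin K s).restrictScalars k ≤ (Algebra.adjoin K t).restrictScalars k := by
  intro x hx
  have h' : Algebra.adjoin K s ≤ Algebra.adjoin K t := Algebra.adjoin_mono h
  exact h' hx

theorem isHopfSubalgebra_adjoin_sUnion {K : Subalgebra k H} (hK : IsHopfSubalgebra K)
    {c : Set (Set H)}
    (hc : ∀ s ∈ c, IsHopfSubalgebra ((Algebra.adjoin K s).restrictScalars k)) :
    IsHopfSubalgebra ((Algebra.adjoin K (⋃₀ c)).restrictScalars k) := by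
  refine isHopfSubalgebra_adjoin hK _ ?_ ?_
  · rintro x ⟨s, hs, hx⟩
    exact mem_range_map_subtype_mono
      (restrictScalars_adjoin_mono K (Set.subset_sUnion_of_mem hs))
      ((hc s hs).isSubcoalgebra x (mem_restrictScalars_adjoin K hx))
  · rintro x ⟨s, hs, hx⟩
    exact restrictScalars_adjoin_mono K (Set.subset_sUnion_of_mem hs)
      ((hc s hs).antipode_mem x (mem_restrictScalars_adjoin K hx))

theorem isHopfSubalgebra_adjoin_insert {K : Subalgebra k H} (hK : IsHopfSubalgebra K)
    {s : Set H} (hs : IsHopfSubalgebra ((Algebra.adjoin K s).restrictScalars k)) {x : H}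
    (hx : comul (R := k) x - x ⊗ₜ 1 - 1 ⊗ₜ x ∈ LinearMap.range (TensorProduct.map
      (Subalgebra.toSubmodule ((Algebra.adjoin K s).restrictScalars k)).subtype
      (Subalgebra.toSubmodule ((Algebra.adjoin K s).restrictScalars k)).subtype)) :
    IsHopfSubalgebra ((Algebra.adjoin K (insert x s)).restrictScalars k) := by
  have hle := restrictScalars_adjoin_mono K (Set.subset_insert x s)
  have hxmem := mem_restrictScalars_adjoin K (Set.mem_insert x s)
  have hanti := sub_mem (hle (antipode_add_mem hs hx)) hxmem
  have hΔ := mem_range_map_subtype_mono hle hx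
  rw [add_sub_cancel_right] at hanti
  refine isHopfSubalgebra_adjoin hK _ ?_ ?_
  · generalize (Algebra.adjoin K (insert x s)).restrictScalars k = F at *
    rintro y (rfl | hy)
    · rw [← mem_range_map_val_iff] at hΔ ⊢
      have h2 : y ⊗ₜ[k] (1 : H) ∈ (Algebra.TensorProduct.map F.val F.val).range :=
        ⟨⟨y, hxmem⟩ ⊗ₜ 1, by simp⟩
      have h3 : (1 : H) ⊗ₜ[k] y ∈ (Algebra.TensorProduct.map F.val F.val).range :=
        ⟨1 ⊗ₜ ⟨y, hxmem⟩, by simp⟩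
      have := add_mem (add_mem hΔ h3) h2
      rwa [sub_add_cancel, sub_add_cancel] at this
    · exact mem_range_map_subtype_mono hle
        (hs.isSubcoalgebra y (mem_restrictScalars_adjoin K hy))
  · rintro y (rfl | hy)
    · exact hanti
    · exact hle (hs.antipode_mem y (mem_restrictScalars_adjoin K hy))

/-- A connected commutative Hopf algebra in characteristic zero is generated, over any Hopf
subalgebra `K`, by a set of elements which are algebraically independent over `K`. -/
theorem IsConnectedHopfAlgebra.exists_algebraicIndependent_adjoin_eq_top [CharZero k]
    (hH : IsConnectedHopfAlgebra k H) {K : Subalgebra k H} (hK : IsHopfSubalgebra K) :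
    ∃ S : Set H, AlgebraicIndependent K ((↑) : S → H) ∧ Algebra.adjoin K S = ⊤ := by
  have hempty : AlgebraicIndependent K ((↑) : (∅ : Set H) → H) :=
    (algebraicIndependent_empty_iff K H).2 Subtype.val_injective
  -- The Hopf condition is part of the poset because finding a primitive x and proving it
  -- transcendental both require it of K[S].
  obtain ⟨S, -, hS⟩ := zorn_subset_nonempty
    {s : Set H | AlgebraicIndependent K ((↑) : s → H) ∧
      IsHopfSubalgebra ((Algebra.adjoin K s).restrictScalars k)} (by
    intro c hc hchain hne
    exact ⟨⋃₀ c, ⟨algebraicIndependent_sUnion_of_directed hne hchain.directedOn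
      fun s hs => (hc hs).1, isHopfSubalgebra_adjoin_sUnion hK fun s hs => (hc hs).2⟩,
      fun s hs => Set.subset_sUnion_of_mem hs⟩) ∅
    ⟨hempty, isHopfSubalgebra_adjoin hK _ (fun x hx => hx.elim) (fun x hx => hx.elim)⟩
  obtain ⟨hind, hhopf⟩ := hS.prop
  refine ⟨S, hind, ?_⟩
  by_contra hne
  obtain ⟨x, hxS, hx⟩ := hH.exists_primitive_mod hhopf.isSubcoalgebra
    (Subalgebra.one_mem ((Algebra.adjoin K S).restrictScalars k))
    (fun h => hne (eq_top_iff.2 fun y _ => by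
      have : y ∈ (⊤ : Submodule k H) := trivial
      rw [← h] at this
      exact this))
  have htr : Transcendental (Algebra.adjoin K S) x := hhopf.transcendental hxS hx
  have hins : AlgebraicIndepOn K id (insert x S) :=
    AlgebraicIndepOn.insert hind (by rwa [Set.image_id])
  have hxS' : x ∈ S := hS.le_of_ge ⟨hins, isHopfSubalgebra_adjoin_insert hK hhopf hx⟩
    (Set.subset_insert x S) (Set.mem_insert x S)
  exact hxS (mem_restrictScalars_adjoin K hxS')

end Adjoin

theorem mainTheorem5 {k : Type u} [Field k] [CharZero k] {H : Type v} [CommRing H]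
    [HopfAlgebra k H] (hH : IsConnectedHopfAlgebra k H)
    (K : Subalgebra k H) (hK : IsHopfSubalgebra K) :
    ∃ Γ : Type v, Nonempty (H ≃ₐ[K] MvPolynomial Γ K) := by
  obtain ⟨S, hind, htop⟩ := hH.exists_algebraicIndependent_adjoin_eq_top hK
  have hrange : Algebra.adjoin K (Set.range ((↑) : S → H)) = ⊤ := by rw [Subtype.range_coe, htop]
  exact ⟨S, ⟨(hind.aevalEquiv.trans
    ((Subalgebra.equivOfEq _ _ hrange).trans Subalgebra.topEquiv)).symm⟩⟩
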